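/- Let $G$ be an (additively written) abelian group. A subgroup $A$ of an abelian group $B$ is called essential in $B$ if $A\cap K\neq\{0\}$ for every non-zero subgroup $K$ of $B$. Call $G$ semi-generalized co-Bassian if, for every subgroup $H\le G$ and every injective homomorphism $\varphi\colon G\to G/H$, there is a direct summand $S$ of $G/H$ such that $\varphi(G)\subseteq S$ and $\varphi(G)$ is essential in $S$. If $G$ is semi-generalized co-Bassian and $p$ is a prime, then the $p$-component of the torsion subgroup of $G$, namely $T_p=\{x\in G : p^n x=0 \text{ for some integer } n\ge 0\}$, is also semi-generalized co-Bassian. -/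

import Mathlib

/-- `A` is an essential subgroup of `B`, for subgroups `A` and `B` of an ambient abelian group:
`A` is contained in `B` and meets every non-zero subgroup of `B` non-trivially. -/
def IsEssentialIn {Q : Type*} [AddCommGroup Q] (A B : AddSubgroup Q) : Prop :=
  A ≤ B ∧ ∀ K : AddSubgroup Q, K ≤ B → K ≠ ⊥ → A ⊓ K ≠ ⊥

/-- `S` is a direct summand of the abelian group `Q`: there is a subgroup `K` with
`S ⊓ K = ⊥` and `S ⊔ K = ⊤`, that is, `Q` is the internal direct sum of `S` and `K`. -/
def IsDirectSummand {Q : Type*} [AddCommGroup Q] (S : AddSubgroup Q) : Prop :=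
  ∃ K : AddSubgroup Q, IsCompl S K

/-- An abelian group `G` is semi-generalized co-Bassian if, for every subgroup `H` and every
injective homomorphism `φ : G → G / H`, the image of `φ` is essential in some direct summand
of `G / H`. -/
def IsSemiGeneralizedCoBassian (G : Type*) [AddCommGroup G] : Prop :=
  ∀ (H : AddSubgroup G) (φ : G →+ G ⧸ H), Function.Injective φ →
    ∃ S : AddSubgroup (G ⧸ H), IsDirectSummand S ∧ IsEssentialIn φ.range S

/-! The property passes to direct summands (`IsSemiGeneralizedCoBassian.of_isCompl`), so it suffices
to split off `T = T_p`. This is possible once some `p ^ n T` is divisible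
(`exists_isCompl_of_divisible`).

To find `n`, take a positive exponent at which the dimension of the socle of `p ^ n T` over `ZMod p`
is least, and put `P = p ^ n T`. If this dimension is finite, the socles are constant from there on,
so socle elements of `P` have infinite height and `P` is divisible. If it is infinite, `P` embeds in
a divisible quotient `P / H` of itself (`exists_embedding_into_divisible_quotient`). Replacing the
projection `G → G / H` by this embedding on the `P / H` part gives an injection to which the
hypothesis applies, and essentiality of its image forces `P` to be divisible
(`IsSemiGeneralizedCoBassian.exists_nsmul_eq`). -/

/-! ### Linear algebra in infinite dimension -/

theorem linearIndependent_of_notMem_span_image_Iio {K V ι : Type*} [DivisionRing K]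
    [AddCommGroup V] [Module K V] [LinearOrder ι] {v : ι → V}
    (h : ∀ i, v i ∉ Submodule.span K (v '' Set.Iio i)) : LinearIndependent K v := by
  classical
  rw [linearIndependent_iff_finset_linearIndependent]
  intro s
  change LinearIndepOn K v (s : Set ι)
  induction s using Finset.induction_on_max with
  | empty => simp
  | insert a s ha ih =>
    have has : a ∉ (s : Set ι) := fun h => lt_irrefl _ (ha a h)
    rw [Finset.coe_insert, linearIndepOn_insert has]
    exact ⟨ih, fun hmem => h a (Submodule.span_mono (Set.image_mono fun x hx => ha x hx) hmem)⟩

open Cardinal in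
/-- Countably many subspaces of the same infinite dimension are simultaneously mapped onto one of
them by a suitable linear map. -/
theorem exists_linearMap_map_eq_top {K V : Type*} [Field K] [AddCommGroup V] [Module K V]
    (U : ℕ → Submodule K V) (hinf : ℵ₀ ≤ Module.rank K (U 0))
    (hU : ∀ n, Module.rank K (U n) = Module.rank K (U 0)) :
    ∃ f : V →ₗ[K] U 0, ∀ n, (U n).map f = ⊤ := by
  classical
  set c := Module.rank K (U 0) with hc
  let ι := c.ord.ToType
  have hι : #ι = c := mk_ord_toType c
  have hprod : #(ι × ℕ) = #ι := by
    rw [mk_prod, mk_nat, lift_aleph0, lift_uzero, hι, mul_aleph0_eq hinf]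
  obtain ⟨e⟩ := Cardinal.eq.1 hprod.symm
  -- Fewer than `c` vectors cannot span a space of dimension `c`, so transfinite recursion yields
  -- independent vectors, `c` of them in each `U n`. The bound sits under the existential to make
  -- the choice function total.
  have hex : ∀ (i : ι) (s : Set V), ∃ x, #s < c →
      x ∈ U (e i).2 ∧ x ∉ Submodule.span K s := by
    intro i s
    by_cases hs : #s < c
    · by_contra! hcon
      have hle : U (e i).2 ≤ Submodule.span K s := fun x hx => (hcon x).2 hx
      have h1 := Submodule.rank_mono hle
      rw [hU] at h1
      exact absurd hs (not_lt.2 (h1.trans (rank_span_le s)))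
    · exact ⟨0, fun h => absurd h hs⟩
  choose g hg using hex
  let v : ι → V := WellFounded.fix (wellFounded_lt (α := ι))
    fun i ih => g i (Set.range fun j : Set.Iio i => ih j j.2)
  have hv : ∀ i, v i = g i (v '' Set.Iio i) := by
    intro i
    rw [Set.image_eq_range]
    exact WellFounded.fix_eq _ _ i
  have hvi : ∀ i, v i ∈ U (e i).2 ∧ v i ∉ Submodule.span K (v '' Set.Iio i) := by
    intro i
    have := hg i (v '' Set.Iio i) (mk_image_le.trans_lt (by
      have h := mk_Iio_lt i (by simp [ι])
      rwa [hι] at h))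
    rwa [← hv] at this
  have hli := linearIndependent_of_notMem_span_image_Iio fun i => (hvi i).2
  let b := Module.Basis.ofVectorSpace K (U 0)
  have hb : #ι = #(Module.Basis.ofVectorSpaceIndex K (U 0)) := by rw [hι, hc, b.mk_eq_rank'']
  obtain ⟨σ⟩ := Cardinal.eq.1 hb
  -- The vector with label `(j, n)` lies in `U n` and is sent to the basis vector numbered `j`, so
  -- each `U n` reaches the whole basis.
  obtain ⟨f, hf⟩ := LinearMap.exists_extend
    ((Module.Basis.span hli).constr K fun i => b (σ (e i).1))
  have hfv : ∀ i, f (v i) = b (σ (e i).1) := by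
    intro i
    have h1 := LinearMap.congr_fun hf (Module.Basis.span hli i)
    rw [Module.Basis.constr_basis] at h1
    rw [← h1, LinearMap.comp_apply, Submodule.subtype_apply, Module.Basis.span_apply]
  refine ⟨f, fun n => ?_⟩
  rw [eq_top_iff, ← b.span_eq, Submodule.span_le]
  rintro _ ⟨j, rfl⟩
  refine ⟨v (e.symm (σ.symm j, n)), ?_, ?_⟩
  · have := (hvi (e.symm (σ.symm j, n))).1
    rwa [Equiv.apply_symm_apply] at this
  · rw [hfv, Equiv.apply_symm_apply, Equiv.apply_symm_apply]

/-! ### Divisible primary subgroups and quotients -/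

/-- Induction on the exponent of `x`: if `p ^ k • x` is in the socle, it equals `p ^ (k + 1) • r`,
and `x - p • r` is killed by `p ^ k`. -/
theorem exists_nsmul_eq_of_forall_socle {Q : Type*} [AddCommGroup Q] {p : ℕ} {E : AddSubgroup Q}
    (hE : ∀ x ∈ E, ∃ k : ℕ, p ^ k • x = 0)
    (hs : ∀ x ∈ E, p • x = 0 → ∀ k : ℕ, ∃ y ∈ E, p ^ k • y = x) :
    ∀ x ∈ E, ∃ y ∈ E, p • y = x := by
  suffices h : ∀ (k : ℕ), ∀ x ∈ E, p ^ k • x = 0 → ∃ y ∈ E, p • y = x by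
    intro x hx
    obtain ⟨k, hk⟩ := hE x hx
    exact h k x hx hk
  intro k
  induction k with
  | zero =>
    intro x _ h
    exact ⟨0, E.zero_mem, by simpa using h.symm⟩
  | succ k ih =>
    intro x hx h
    obtain ⟨r, hr, hrx⟩ := hs (p ^ k • x) (E.nsmul_mem hx _)
      (by rw [← mul_nsmul', ← pow_succ', h]) (k + 1)
    obtain ⟨y, hy, hyx⟩ := ih (x - p • r) (E.sub_mem hx (E.nsmul_mem hr _))
      (by rw [nsmul_sub, ← hrx, ← mul_nsmul', ← pow_succ, sub_self])
    exact ⟨y + r, E.add_mem hy hr, by rw [nsmul_add, hyx, sub_add_cancel]⟩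

theorem exists_pow_nsmul_eq {Q : Type*} [AddCommGroup Q] {p : ℕ} {E : AddSubgroup Q}
    (hd : ∀ x ∈ E, ∃ y ∈ E, p • y = x) (k : ℕ) : ∀ x ∈ E, ∃ y ∈ E, p ^ k • y = x := by
  induction k with
  | zero => exact fun x hx => ⟨x, hx, by simp⟩
  | succ k ih =>
    intro x hx
    obtain ⟨y, hy, rfl⟩ := ih x hx
    obtain ⟨z, hz, rfl⟩ := hd y hy
    exact ⟨z, hz, by rw [← mul_nsmul', ← pow_succ]⟩

theorem exists_zsmul_eq_of_primary {Q : Type*} [AddCommGroup Q] {p : ℕ} (hp : p.Prime)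
    {E : AddSubgroup Q} (hE : ∀ x ∈ E, ∃ k : ℕ, p ^ k • x = 0)
    (hd : ∀ x ∈ E, ∃ y ∈ E, p • y = x) {n : ℤ} (hn : n ≠ 0) :
    ∀ x ∈ E, ∃ y ∈ E, n • y = x := by
  intro x hx
  obtain ⟨a, m, hm, hnm⟩ := Nat.exists_eq_pow_mul_and_not_dvd (Int.natAbs_ne_zero.2 hn) p hp.ne_one
  obtain ⟨y, hy, rfl⟩ := exists_pow_nsmul_eq hd a x hx
  obtain ⟨k, hk⟩ := hE y hy
  have hcop : IsCoprime (m : ℤ) ((p ^ k : ℕ) : ℤ) :=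
    Nat.isCoprime_iff_coprime.2 (((Nat.Prime.coprime_iff_not_dvd hp).2 hm).symm.pow_right k)
  obtain ⟨u, w, huw⟩ := hcop
  have hy1 : (m : ℤ) • (u • y) = y := by
    calc (m : ℤ) • (u • y) = (u * m + w * ((p ^ k : ℕ) : ℤ)) • y := by
          rw [add_smul, mul_smul w, natCast_zsmul y (p ^ k), hk, smul_zero, add_zero, mul_comm,
            mul_smul]
      _ = y := by rw [huw, one_smul]
  have habs : (n.natAbs : ℤ) • (u • y) = p ^ a • y := by
    rw [hnm, Nat.cast_mul, mul_smul, hy1, natCast_zsmul]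
  rcases Int.natAbs_eq n with h | h
  · exact ⟨u • y, E.zsmul_mem hy _, by rw [h, habs]⟩
  · exact ⟨-(u • y), E.neg_mem (E.zsmul_mem hy _), by rw [h, neg_smul_neg, habs]⟩

/-- Homomorphisms into a divisible primary subgroup extend along injections. -/
theorem exists_extension_of_divisible {A B Q : Type*} [AddCommGroup A] [AddCommGroup B]
    [AddCommGroup Q] {p : ℕ} (hp : p.Prime) {E : AddSubgroup Q}
    (hE : ∀ x ∈ E, ∃ k : ℕ, p ^ k • x = 0) (hd : ∀ x ∈ E, ∃ y ∈ E, p • y = x)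
    (i : A →+ B) (hi : Function.Injective i) (f : A →+ Q) (hf : ∀ a, f a ∈ E) :
    ∃ h : B →+ Q, (∀ b, h b ∈ E) ∧ ∀ a, h (i a) = f a := by
  let : DivisibleBy E ℤ := divisibleByOfSMulRightSurj E ℤ fun {n} hn x => by
    obtain ⟨y, hy, hyx⟩ := exists_zsmul_eq_of_primary hp hE hd hn x x.2
    exact ⟨⟨y, hy⟩, Subtype.ext hyx⟩
  obtain ⟨h, hh⟩ := (Module.Baer.of_divisible E).extension_property_addMonoidHom i hi
    (f.codRestrict E hf)
  exact ⟨E.subtype.comp h, fun b => (h b).2, fun a => congrArg Subtype.val (DFunLike.congr_fun hh a)⟩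

/-- Let `W` and `X` be disjoint subgroups of an abelian `p`-group `T` such that `X` lies in the
`p`-adic closure of `W`. A subgroup of `T` maximal among those containing `W` and disjoint from `X`
has divisible quotient. -/
theorem exists_disjoint_divisible_quotient {G : Type*} [AddCommGroup G] {p : ℕ} (hp : p.Prime)
    {T W X : AddSubgroup G} (hT : ∀ x ∈ T, ∃ k : ℕ, p ^ k • x = 0) (hWT : W ≤ T)
    (hWX : Disjoint W X)
    (hdense : ∀ x ∈ X, ∀ k : ℕ, ∃ y ∈ T, x - p ^ k • y ∈ W) :
    ∃ H ≤ T, Disjoint H X ∧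
      ∀ q ∈ T.map (QuotientAddGroup.mk' H), ∃ r ∈ T.map (QuotientAddGroup.mk' H), p • r = q := by
  obtain ⟨H, hWH, hH⟩ := zorn_le_nonempty₀ {H : AddSubgroup G | H ≤ T ∧ Disjoint H X} (by
    intro c hc hchain y hy
    refine ⟨sSup c, ⟨sSup_le fun K hK => (hc hK).1, ?_⟩, fun z hz => le_sSup hz⟩
    rw [AddSubgroup.disjoint_def]
    intro x hx hxX
    obtain ⟨K, hK, hxK⟩ := (AddSubgroup.mem_sSup_of_directedOn ⟨y, hy⟩ hchain.directedOn).1 hx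
    exact AddSubgroup.disjoint_def.1 (hc hK).2 hxK hxX) W ⟨hWT, hWX⟩
  refine ⟨H, hH.prop.1, hH.prop.2, exists_nsmul_eq_of_forall_socle ?_ ?_⟩
  · rintro _ ⟨t, ht, rfl⟩
    obtain ⟨k, hk⟩ := hT t ht
    exact ⟨k, by rw [← map_nsmul, hk, map_zero]⟩
  rintro _ ⟨t, ht, rfl⟩ hpt k
  have hpt' : p • t ∈ H := by
    rwa [← map_nsmul, QuotientAddGroup.mk'_apply, QuotientAddGroup.eq_zero_iff] at hpt
  suffices h : ∃ y ∈ T, t - p ^ k • y ∈ H by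
    obtain ⟨y, hy, h⟩ := h
    refine ⟨_, ⟨y, hy, rfl⟩, ?_⟩
    rw [← map_nsmul, eq_comm, ← sub_eq_zero, ← map_sub, QuotientAddGroup.mk'_apply,
      QuotientAddGroup.eq_zero_iff]
    exact h
  by_cases htH : t ∈ H
  · exact ⟨0, T.zero_mem, by simpa using htH⟩
  have hnd : ¬ Disjoint (H ⊔ AddSubgroup.zmultiples t) X := by
    intro hdis
    refine htH (hH.le_of_ge ⟨sup_le hH.prop.1 ?_, hdis⟩ le_sup_left
      (AddSubgroup.mem_sup_right (AddSubgroup.mem_zmultiples t)))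
    simpa using ht
  rw [AddSubgroup.disjoint_def] at hnd
  push Not at hnd
  obtain ⟨x, hx, hxX, hx0⟩ := hnd
  obtain ⟨h, hh, z, hz, rfl⟩ := AddSubgroup.mem_sup.1 hx
  obtain ⟨m, rfl⟩ := AddSubgroup.mem_zmultiples_iff.1 hz
  have hpm : ¬ (p : ℤ) ∣ m := by
    rintro ⟨l, rfl⟩
    refine hx0 (AddSubgroup.disjoint_def.1 hH.prop.2 (H.add_mem hh ?_) hxX)
    rw [mul_comm, mul_smul, natCast_zsmul]
    exact H.zsmul_mem hpt' _
  -- By Bézout, `t` is congruent modulo `H` to `a` times an element of `X`, and so inherits its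
  -- approximations by `p ^ k`-multiples.
  obtain ⟨b, a, hab⟩ := ((Nat.prime_iff_prime_int.1 hp).coprime_iff_not_dvd).2 hpm
  obtain ⟨y, hy, hyW⟩ := hdense _ hxX k
  refine ⟨a • y, T.zsmul_mem hy _, ?_⟩
  have key : t - p ^ k • (a • y) = a • (h + m • t - p ^ k • y) - a • h + b • (p • t) := by
    conv_lhs => rw [← one_smul ℤ t, ← hab]
    module
  rw [key]
  exact H.add_mem (H.sub_mem (H.zsmul_mem (hWH hyW) _) (H.zsmul_mem hh _)) (H.zsmul_mem hpt' _)

/-! ### Splitting off the `p`-component -/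

theorem complementedLattice_addSubgroup_of_zmodModule (Q : Type*) [AddCommGroup Q] (p : ℕ)
    [Fact p.Prime] [Module (ZMod p) Q] : ComplementedLattice (AddSubgroup Q) :=
  (AddSubgroup.toZModSubmodule (M := Q) p).complementedLattice_iff.2 inferInstance

theorem complementedLattice_addSubgroup_of_nsmul_eq_zero {Q : Type*} [AddCommGroup Q] {p : ℕ}
    (hp : p.Prime) (h : ∀ x : Q, p • x = 0) : ComplementedLattice (AddSubgroup Q) :=
  have := Fact.mk hp
  let _ : Module (ZMod p) Q := AddCommGroup.zmodModule h
  complementedLattice_addSubgroup_of_zmodModule Q p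

/-- `K` is the preimage of a complement of the image of `A` in the vector space `G / pG`. -/
theorem exists_sup_eq_top_inf_le_nsmul {G : Type*} [AddCommGroup G] {p : ℕ} (hp : p.Prime)
    (A : AddSubgroup G) : ∃ K : AddSubgroup G, K ⊔ A = ⊤ ∧ ∀ x ∈ K ⊓ A, ∃ g, p • g = x := by
  let N : AddSubgroup G := (nsmulAddMonoidHom p : G →+ G).range
  have := complementedLattice_addSubgroup_of_nsmul_eq_zero (Q := G ⧸ N) hp (by
    intro x
    obtain ⟨g, rfl⟩ := QuotientAddGroup.mk'_surjective N x
    rw [← map_nsmul, QuotientAddGroup.mk'_apply, QuotientAddGroup.eq_zero_iff]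
    exact ⟨g, rfl⟩)
  obtain ⟨C, hC⟩ := exists_isCompl (A.map (QuotientAddGroup.mk' N))
  refine ⟨C.comap (QuotientAddGroup.mk' N), ?_, ?_⟩
  · rw [eq_top_iff]
    intro g _
    obtain ⟨u, hu, c, hc, huc⟩ := AddSubgroup.mem_sup.1
      (hC.sup_eq_top.ge (AddSubgroup.mem_top (QuotientAddGroup.mk' N g)))
    obtain ⟨a, ha, rfl⟩ := hu
    refine AddSubgroup.mem_sup.2 ⟨g - a, ?_, a, ha, sub_add_cancel _ _⟩
    change QuotientAddGroup.mk' N (g - a) ∈ C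
    rw [map_sub, ← huc, add_sub_cancel_left]
    exact hc
  · rintro x ⟨hxK, hxA⟩
    have h0 := AddSubgroup.disjoint_def.1 hC.disjoint
      (AddSubgroup.mem_map_of_mem (QuotientAddGroup.mk' N) hxA) hxK
    rwa [QuotientAddGroup.mk'_apply, QuotientAddGroup.eq_zero_iff] at h0

theorem exists_isCompl_of_divisible {G : Type*} [AddCommGroup G] {p : ℕ} (hp : p.Prime)
    {T : AddSubgroup G} (hT : ∀ x, x ∈ T ↔ ∃ k : ℕ, p ^ k • x = 0) (n : ℕ)
    (hd : ∀ x ∈ T.map (nsmulAddMonoidHom (p ^ n)),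
      ∃ y ∈ T.map (nsmulAddMonoidHom (p ^ n)), p • y = x) :
    ∃ K, IsCompl T K := by
  have hPT : T.map (nsmulAddMonoidHom (p ^ n)) ≤ T := by
    rintro _ ⟨t, ht, rfl⟩
    exact T.nsmul_mem ht _
  obtain ⟨K, hKT, hK⟩ : ∃ K : AddSubgroup G, K ⊔ T = ⊤ ∧
      K ⊓ T ≤ T.map (nsmulAddMonoidHom (p ^ n)) := by
    clear hd hPT
    induction n with
    | zero => exact ⟨⊤, top_sup_eq _, fun x hx => ⟨x, hx.2, by simp⟩⟩
    | succ n ih =>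
      obtain ⟨K, hKT, hK⟩ := ih
      -- An element of `L ∩ T` is `p • g` with `g ∈ K`. Then `g` is `p`-power torsion, so it lies in
      -- `K ∩ T ≤ p ^ n T`, which gains one power of `p`.
      obtain ⟨L, hL, hLK⟩ := exists_sup_eq_top_inf_le_nsmul hp (T.addSubgroupOf K)
      refine ⟨L.map K.subtype, ?_, ?_⟩
      · rw [eq_top_iff]
        intro g _
        obtain ⟨k, hk, t, ht, rfl⟩ := AddSubgroup.mem_sup.1 (hKT.ge (AddSubgroup.mem_top g))
        obtain ⟨l, hl, a, ha, hla⟩ := AddSubgroup.mem_sup.1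
          (hL.ge (AddSubgroup.mem_top (⟨k, hk⟩ : K)))
        refine AddSubgroup.mem_sup.2 ⟨l, ⟨l, hl, rfl⟩, a + t, T.add_mem ha ht, ?_⟩
        rw [← add_assoc]
        exact congrArg (· + t) (congrArg Subtype.val hla)
      · rintro _ ⟨⟨l, hl, rfl⟩, hlT⟩
        obtain ⟨g, rfl⟩ := hLK l ⟨hl, hlT⟩
        have hgT : (g : G) ∈ T := by
          obtain ⟨k, hk⟩ := (hT _).1 hlT
          refine (hT _).2 ⟨k + 1, ?_⟩
          rw [pow_succ, mul_nsmul']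
          exact hk
        obtain ⟨t, ht, htg⟩ := hK ⟨g.2, hgT⟩
        refine ⟨t, ht, ?_⟩
        change p ^ n • t = g at htg
        change p ^ (n + 1) • t = p • (g : G)
        rw [← htg, ← mul_nsmul', pow_succ']
  obtain ⟨ρ, hρ, hρid⟩ := exists_extension_of_divisible hp (fun x hx => (hT x).1 (hPT hx)) hd
    (T.map (nsmulAddMonoidHom (p ^ n))).subtype Subtype.val_injective
    (T.map (nsmulAddMonoidHom (p ^ n))).subtype fun a => a.2
  -- `ρ` is the identity on `p ^ n T ⊇ K ∩ T`, so shearing `K` by `ρ` kills the intersection and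
  -- changes elements only by members of `T`.
  refine ⟨K.map (AddMonoidHom.id G - ρ), ?_, ?_⟩
  · rw [AddSubgroup.disjoint_def]
    rintro _ hxT ⟨k, hk, rfl⟩
    change k - ρ k ∈ T at hxT
    have hkT : k ∈ T := by simpa using T.add_mem hxT (hPT (hρ k))
    have h := hρid ⟨k, hK ⟨hk, hkT⟩⟩
    exact sub_eq_zero.2 h.symm
  · rw [codisjoint_iff, eq_top_iff]
    intro g _
    obtain ⟨k, hk, t, ht, rfl⟩ := AddSubgroup.mem_sup.1 (hKT.ge (AddSubgroup.mem_top g))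
    refine AddSubgroup.mem_sup.2 ⟨ρ k + t, T.add_mem (hPT (hρ k)) ht, k - ρ k, ⟨k, hk, rfl⟩, ?_⟩
    abel

/-! ### Passage to direct summands -/

/-- Extend `φ` by the identity on `C`. The summand `S` obtained for `G` contains the image of `C`,
so it is the sum of that image and its trace on `T ⧸ H`; the trace is the required summand. -/
theorem IsSemiGeneralizedCoBassian.of_isCompl {G : Type*} [AddCommGroup G]
    (hG : IsSemiGeneralizedCoBassian G) {T C : AddSubgroup G} (hTC : IsCompl T C) :
    IsSemiGeneralizedCoBassian T := by
  intro H φ hφ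
  obtain ⟨τ, hτ, hτC⟩ : ∃ τ : G →+ T, (∀ t : T, τ t = t) ∧ ∀ g, g - τ g ∈ C := by
    have hTC' : IsCompl (AddSubgroup.toIntSubmodule T) (AddSubgroup.toIntSubmodule C) :=
      (AddSubgroup.toIntSubmodule (M := G)).isCompl hTC
    have hid := Submodule.projectionOnto_apply_left hTC'
    refine ⟨(Submodule.projectionOnto _ _ hTC').toAddMonoidHom, hid, fun g => ?_⟩
    refine (Submodule.projectionOnto_apply_eq_zero_iff hTC').1 ?_
    rw [map_sub]
    exact sub_eq_zero.2 (hid _).symm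
  let H' : AddSubgroup G := H.map T.subtype
  let mk := QuotientAddGroup.mk' H'
  let j : T ⧸ H →+ G ⧸ H' := QuotientAddGroup.map H H' T.subtype (AddSubgroup.le_comap_map _ _)
  let r : G ⧸ H' →+ T ⧸ H := QuotientAddGroup.map H' H τ (by
    rintro _ ⟨h, hh, rfl⟩
    change τ h ∈ H
    rwa [hτ])
  have hrmk : ∀ g, r (mk g) = QuotientAddGroup.mk' H (τ g) := fun g => rfl
  have hrj : ∀ x, r (j x) = x := by
    intro x
    obtain ⟨t, rfl⟩ := QuotientAddGroup.mk'_surjective H x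
    change QuotientAddGroup.mk' H (τ t) = _
    rw [hτ]
  have hjr : ∀ g, mk g - j (r (mk g)) = mk (g - τ g) := fun g => (map_sub mk g (τ g : G)).symm
  have hrC : ∀ g, r (mk (g - τ g)) = 0 := by
    intro g
    rw [hrmk, map_sub, hτ, sub_self, map_zero]
  let ψ : G →+ G ⧸ H' := (j.comp φ).comp τ + mk.comp (AddMonoidHom.id G - T.subtype.comp τ)
  have hψ : ∀ g, ψ g = j (φ (τ g)) + mk (g - τ g) := fun g => rfl
  have hrψ : ∀ g, r (ψ g) = φ (τ g) := by
    intro g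
    rw [hψ, map_add, hrj, hrC, add_zero]
  have hψT : ∀ t : T, ψ t = j (φ t) := by
    intro t
    rw [hψ, hτ, sub_self, map_zero, add_zero]
  have hψC : ∀ g, ψ (g - τ g) = mk (g - τ g) := by
    intro g
    have h0 : τ (g - τ g) = 0 := by rw [map_sub, hτ, sub_self]
    rw [hψ, h0, map_zero, map_zero, zero_add, ZeroMemClass.coe_zero, sub_zero]
  obtain ⟨S, ⟨K, hSK⟩, hS, hess⟩ := hG H' ψ (by
    rw [injective_iff_map_eq_zero]
    intro g hg
    have h1 : τ g = 0 := by
      apply (injective_iff_map_eq_zero φ).1 hφ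
      rw [← hrψ, hg, map_zero]
    have h2 : mk g = 0 := by
      rwa [hψ, h1, map_zero, map_zero, zero_add, ZeroMemClass.coe_zero, sub_zero] at hg
    obtain ⟨h, hh, rfl⟩ := (QuotientAddGroup.eq_zero_iff g).1 h2
    change τ h = 0 at h1
    rw [hτ] at h1
    rw [h1, map_zero])
  have hCS : ∀ x, x - j (r x) ∈ S := by
    intro x
    obtain ⟨g, rfl⟩ := QuotientAddGroup.mk'_surjective H' x
    rw [hjr, ← hψC]
    exact hS ⟨_, rfl⟩
  refine ⟨S.comap j, ⟨K.map r, ?_, ?_⟩, ?_, ?_⟩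
  · rw [AddSubgroup.disjoint_def]
    rintro _ hx ⟨k, hk, rfl⟩
    change j (r k) ∈ S at hx
    have hkS : k ∈ S := by simpa using S.add_mem (hCS k) hx
    rw [AddSubgroup.disjoint_def.1 hSK.disjoint hkS hk, map_zero]
  · rw [codisjoint_iff, eq_top_iff]
    intro x _
    obtain ⟨s, hs, k, hk, hsk⟩ :=
      AddSubgroup.mem_sup.1 (hSK.sup_eq_top.ge (AddSubgroup.mem_top (j x)))
    refine AddSubgroup.mem_sup.2 ⟨r s, ?_, r k, ⟨k, hk, rfl⟩, by rw [← map_add, hsk, hrj]⟩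
    change j (r s) ∈ S
    simpa using S.sub_mem hs (hCS s)
  · rintro _ ⟨t, rfl⟩
    exact hS ⟨t, hψT t⟩
  · intro L hL hL0 hbot
    refine hess (L.map j) (AddSubgroup.map_le_iff_le_comap.2 hL) ?_ ?_
    · rwa [Ne, AddSubgroup.map_eq_bot_iff_of_injective _ (Function.LeftInverse.injective hrj)]
    · rw [eq_bot_iff]
      rintro _ ⟨⟨g, rfl⟩, l, hl, hlg⟩
      have h1 : l = φ (τ g) := by rw [← hrψ, ← hlg, hrj]
      have h2 : l ∈ φ.range ⊓ L := ⟨⟨_, h1.symm⟩, hl⟩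
      rw [hbot, AddSubgroup.mem_bot] at h2
      rw [AddSubgroup.mem_bot, ← hlg, h2, map_zero]

/-! ### Divisibility of some `p ^ n T` -/

/-- If `p ^ n T` (with `n ≥ 1`) has a divisible quotient into which it embeds, then it is itself
divisible. -/
theorem IsSemiGeneralizedCoBassian.exists_nsmul_eq {G : Type*} [AddCommGroup G]
    (hG : IsSemiGeneralizedCoBassian G) {p : ℕ} (hp : p.Prime) {T : AddSubgroup G}
    (hT : ∀ x, x ∈ T ↔ ∃ k : ℕ, p ^ k • x = 0) {n : ℕ} {P H : AddSubgroup G}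
    (hP : P = T.map (nsmulAddMonoidHom (p ^ (n + 1)))) (hHP : H ≤ P)
    (hd : ∀ q ∈ P.map (QuotientAddGroup.mk' H), ∃ r ∈ P.map (QuotientAddGroup.mk' H), p • r = q)
    (e : G →+ G ⧸ H) (he : ∀ g, e g ∈ P.map (QuotientAddGroup.mk' H))
    (hinj : ∀ g ∈ P, e g = 0 → g = 0) : ∀ x ∈ P, ∃ y ∈ P, p • y = x := by
  set mk := QuotientAddGroup.mk' H with hmk
  set E := P.map mk with hEdef
  have hmk0 : ∀ g, mk g = 0 ↔ g ∈ H := fun g => QuotientAddGroup.eq_zero_iff g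
  have hPmem : ∀ t ∈ T, p ^ (n + 1) • t ∈ P := fun t ht => hP ▸ ⟨t, ht, rfl⟩
  have hPT : P ≤ T := by
    rw [hP]
    rintro _ ⟨t, ht, rfl⟩
    exact T.nsmul_mem ht _
  have hE : ∀ x ∈ E, ∃ k : ℕ, p ^ k • x = 0 := by
    rintro _ ⟨x, hx, rfl⟩
    obtain ⟨k, hk⟩ := (hT x).1 (hPT hx)
    exact ⟨k, by rw [← map_nsmul, hk, map_zero]⟩
  have hmkE : ∀ g, mk g ∈ E → g ∈ P := by
    rintro g ⟨x, hx, hxg⟩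
    have h : g - x ∈ H := by rw [← hmk0, map_sub, hxg, sub_self]
    simpa using P.add_mem (hHP h) hx
  obtain ⟨ρ, hρ, hρid⟩ := exists_extension_of_divisible hp hE hd E.subtype
    Subtype.val_injective E.subtype fun a => a.2
  -- `φ` agrees with `mk` modulo `E` and with `e` on `P`. Hence its kernel lies in `P`, where `e` is
  -- injective.
  let φ : G →+ G ⧸ H := mk - ρ.comp mk + e
  have hφ : ∀ g, φ g = mk g - ρ (mk g) + e g := fun g => rfl
  have hφP : ∀ g ∈ P, φ g = e g := by
    intro g hg
    have h : ρ (mk g) = mk g := hρid ⟨mk g, g, hg, rfl⟩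
    rw [hφ, h, sub_self, zero_add]
  have hφE : ∀ g, mk g - φ g ∈ E := by
    intro g
    have h : mk g - φ g = ρ (mk g) - e g := by rw [hφ]; abel
    rw [h]
    exact E.sub_mem (hρ _) (he g)
  have hφinj : Function.Injective φ := by
    rw [injective_iff_map_eq_zero]
    intro g hg
    have h := hφE g
    rw [hg, sub_zero] at h
    exact hinj g (hmkE g h) (by rw [← hφP g (hmkE g h), hg])
  obtain ⟨S, ⟨K, hSK⟩, hS, hess⟩ := hG H φ hφinj
  rw [hP]
  rintro _ ⟨a, ha, rfl⟩
  change ∃ y ∈ _, p • y = p ^ (n + 1) • a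
  obtain ⟨d, hdS, hdE, hda⟩ : ∃ d ∈ S, d ∈ E ∧ p ^ (n + 1) • d = p ^ (n + 1) • φ a := by
    have hu : p ^ (n + 1) • φ a ∈ E := by
      rw [← map_nsmul, hφP _ (hPmem a ha)]
      exact he _
    -- The exponent is doubled because the `S`-component `s` of `w` is only known to lift to `T`:
    -- one factor `p ^ (n + 1)` moves it into `E`, the other is the one in the claim.
    obtain ⟨w, hw, hwu⟩ := exists_pow_nsmul_eq hd (n + 1 + (n + 1)) _ hu
    obtain ⟨s, hs, k, hk, rfl⟩ := AddSubgroup.mem_sup.1 (hSK.sup_eq_top.ge (AddSubgroup.mem_top w))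
    have hsplit : ∀ m : ℕ, m • (s + k) ∈ S → m • (s + k) = m • s := by
      intro m hm
      rw [nsmul_add] at hm ⊢
      have h : m • k ∈ S := by simpa using S.sub_mem hm (S.nsmul_mem hs m)
      rw [AddSubgroup.disjoint_def.1 hSK.disjoint h (K.nsmul_mem hk m), add_zero]
    refine ⟨p ^ (n + 1) • s, S.nsmul_mem hs _, ?_, ?_⟩
    · obtain ⟨i, hi⟩ := hE _ hw
      have hi' : p ^ i • s = 0 := by
        rw [← hsplit _ (by rw [hi]; exact S.zero_mem), hi]
      obtain ⟨g, rfl⟩ := QuotientAddGroup.mk'_surjective H s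
      have hgT : g ∈ T := by
        rw [← map_nsmul] at hi'
        obtain ⟨l, hl⟩ := (hT _).1 (hPT (hHP ((hmk0 _).1 hi')))
        exact (hT _).2 ⟨l + i, by rw [pow_add, mul_nsmul', hl]⟩
      exact ⟨_, hPmem g hgT, map_nsmul _ _ _⟩
    · rw [← mul_nsmul', ← pow_add, ← hsplit _ (by rw [hwu]; exact S.nsmul_mem (hS ⟨a, rfl⟩) _), hwu]
  -- One factor `p` is held back, which is why the exponent must be positive: `z` is then in the
  -- socle of `S`, and essentiality puts it in the range of `φ`.
  set z := p ^ n • (φ a - d) with hz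
  have hzS : z ∈ S := S.nsmul_mem (S.sub_mem (hS ⟨a, rfl⟩) hdS) _
  have hpz : p • z = 0 := by
    rw [hz, ← mul_nsmul', ← pow_succ', nsmul_sub, hda, sub_self]
  obtain ⟨t, htz⟩ : ∃ t, φ t = z := by
    by_cases hz0 : z = 0
    · exact ⟨0, by rw [hz0, map_zero]⟩
    have h := hess (AddSubgroup.zmultiples z) (by simpa using hzS) (by simpa using hz0)
    rw [Ne, AddSubgroup.eq_bot_iff_forall] at h
    push Not at h
    obtain ⟨_, ⟨⟨g, rfl⟩, hgz⟩, hg0⟩ := h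
    obtain ⟨m, hm⟩ := AddSubgroup.mem_zmultiples_iff.1 hgz
    have hpm : ¬ (p : ℤ) ∣ m := by
      rintro ⟨l, rfl⟩
      exact hg0 (by rw [← hm, mul_comm, mul_smul, natCast_zsmul, hpz, smul_zero])
    obtain ⟨b, c, hbc⟩ := ((Nat.prime_iff_prime_int.1 hp).coprime_iff_not_dvd).2 hpm
    refine ⟨c • g, ?_⟩
    rw [map_zsmul, ← hm]
    calc c • m • z = (b * p + c * m) • z := by
          rw [add_smul, mul_smul b, natCast_zsmul, hpz, smul_zero, zero_add, mul_smul]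
      _ = z := by rw [hbc, one_smul]
  have hpt : p • t = 0 := hφinj (by rw [map_nsmul, htz, hpz, map_zero])
  -- Modulo `E`, `φ` is `mk` and `d` vanishes, so `φ t = z` becomes a congruence between `t` and `p
  -- ^ n • a` modulo `P`.
  have hmem : p ^ n • a - t ∈ P := by
    refine hmkE _ ?_
    have h : mk (p ^ n • a - t) = p ^ n • (mk a - φ a) - (mk t - φ t) + p ^ n • d := by
      rw [htz, hz, map_sub, map_nsmul]
      simp only [nsmul_sub]
      abel
    rw [h]
    exact E.add_mem (E.sub_mem (E.nsmul_mem (hφE a) _) (hφE t)) (E.nsmul_mem hdE _)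
  rw [← hP]
  exact ⟨_, hmem, by rw [nsmul_sub, hpt, sub_zero, ← mul_nsmul', ← pow_succ']⟩

-- `U k` is the part of the socle lying in `p ^ k P`. Since `f` maps every `U k` onto `U 0`, a
-- section `s` has image `X` disjoint from the kernel part `W`, and each element of `X` is congruent
-- modulo `W` to an element of every `U k`. A suitable `H ⊇ W` disjoint from `X` has `P / H`
-- divisible, and `X`, a copy of the socle of `P`, embeds in it. The extension `e` is injective on
-- the socle of `P`, hence on `P`.
open Cardinal in
theorem exists_embedding_into_divisible_quotient {G M : Type*} [AddCommGroup G] [AddCommGroup M]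
    {p : ℕ} [hp : Fact p.Prime] [Module (ZMod p) M] {i : M →+ G} (hi : Function.Injective i)
    (hrange : ∀ g, p • g = 0 → ∃ m, i m = g) {P : AddSubgroup G}
    (hP : ∀ x ∈ P, ∃ k : ℕ, p ^ k • x = 0) {U : ℕ → Submodule (ZMod p) M}
    (hU : ∀ k m, m ∈ U k ↔ ∃ y ∈ P, p ^ k • y = i m)
    (hinf : ℵ₀ ≤ Module.rank (ZMod p) (U 0))
    (hrank : ∀ k, Module.rank (ZMod p) (U k) = Module.rank (ZMod p) (U 0)) :
    ∃ H ≤ P,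
      (∀ q ∈ P.map (QuotientAddGroup.mk' H), ∃ r ∈ P.map (QuotientAddGroup.mk' H), p • r = q) ∧
      ∃ e : G →+ G ⧸ H, (∀ g, e g ∈ P.map (QuotientAddGroup.mk' H)) ∧
        ∀ g ∈ P, e g = 0 → g = 0 := by
  obtain ⟨f, hf⟩ := exists_linearMap_map_eq_top U hinf hrank
  have hU0 : ∀ m, m ∈ U 0 ↔ i m ∈ P := fun m => by simp [hU]
  have hle : ∀ k, U k ≤ U 0 := by
    intro k m hm
    obtain ⟨y, hy, hym⟩ := (hU k m).1 hm
    exact (hU0 m).2 (hym ▸ P.nsmul_mem hy _)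
  obtain ⟨s, hs⟩ := (f.comp (U 0).subtype).exists_rightInverse_of_surjective (by
    rw [LinearMap.range_comp, Submodule.range_subtype, hf])
  have hfs : ∀ u, f (s u) = u := fun u => LinearMap.congr_fun hs u
  let W : AddSubgroup G := (LinearMap.ker f ⊓ U 0).toAddSubgroup.map i
  let X : AddSubgroup G := (i.comp ((U 0).subtype.comp s).toAddMonoidHom).range
  have hWX : Disjoint W X := by
    rw [AddSubgroup.disjoint_def]
    rintro _ ⟨w, hw, rfl⟩ ⟨u, hu⟩
    have hwu : ((s u : U 0) : M) = w := hi hu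
    have hfw : f w = 0 := hw.1
    have hu0 : u = 0 := by rw [← hfs u, hwu, hfw]
    rw [← hwu, hu0, map_zero, ZeroMemClass.coe_zero, map_zero]
  obtain ⟨H, hHP, hHX, hd⟩ := exists_disjoint_divisible_quotient hp.out hP (W := W) (X := X)
    (by
      rintro _ ⟨w, hw, rfl⟩
      exact (hU0 w).1 hw.2) hWX (by
      rintro _ ⟨u, rfl⟩ k
      obtain ⟨v, hv, hvu⟩ := (hf k).ge (Submodule.mem_top (x := u))
      obtain ⟨y, hy, hyv⟩ := (hU k v).1 hv
      refine ⟨y, hy, (s u : M) - v, ⟨?_, (U 0).sub_mem (s u).2 (hle k hv)⟩, ?_⟩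
      · change f _ = 0
        rw [map_sub, hfs, hvu, sub_self]
      · rw [hyv, map_sub]
        rfl)
  have hE : ∀ x ∈ P.map (QuotientAddGroup.mk' H), ∃ k : ℕ, p ^ k • x = 0 := by
    rintro _ ⟨x, hx, rfl⟩
    obtain ⟨k, hk⟩ := hP x hx
    exact ⟨k, by rw [← map_nsmul, hk, map_zero]⟩
  obtain ⟨e, he, hei⟩ := exists_extension_of_divisible hp.out hE hd
    (i.comp (U 0).subtype.toAddMonoidHom) (hi.comp Subtype.val_injective)
    ((QuotientAddGroup.mk' H).comp (i.comp ((U 0).subtype.comp s).toAddMonoidHom))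
    fun u => ⟨_, (hU0 _).1 (s u).2, rfl⟩
  have hsocle : ∀ g ∈ P, p • g = 0 → e g = 0 → g = 0 := by
    intro g hg hpg heg
    obtain ⟨m, rfl⟩ := hrange g hpg
    have h := hei ⟨m, (hU0 m).2 hg⟩
    change e (i m) = QuotientAddGroup.mk' H (i (s ⟨m, _⟩)) at h
    rw [heg, eq_comm, QuotientAddGroup.mk'_apply, QuotientAddGroup.eq_zero_iff] at h
    have h0 := AddSubgroup.disjoint_def.1 hHX h ⟨_, rfl⟩
    have h1 := hfs ⟨m, (hU0 m).2 hg⟩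
    rw [(injective_iff_map_eq_zero i).1 hi _ h0, map_zero] at h1
    rw [show m = 0 from congrArg Subtype.val h1.symm, map_zero]
  refine ⟨H, hHP, hd, e, he, fun g hg heg => ?_⟩
  obtain ⟨k, hk⟩ := hP g hg
  induction k with
  | zero => simpa using hk
  | succ k ih =>
    exact ih (hsocle _ (P.nsmul_mem hg _) (by rw [← mul_nsmul', ← pow_succ', hk])
      (by rw [map_nsmul, heg, nsmul_zero]))

open Cardinal in
theorem IsSemiGeneralizedCoBassian.exists_divisible_map_nsmul {G M : Type*} [AddCommGroup G]
    [AddCommGroup M] (hG : IsSemiGeneralizedCoBassian G) {p : ℕ} [hp : Fact p.Prime]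
    [Module (ZMod p) M] {i : M →+ G} (hi : Function.Injective i)
    (hrange : ∀ g, p • g = 0 → ∃ m, i m = g) {T : AddSubgroup G}
    (hT : ∀ x, x ∈ T ↔ ∃ k : ℕ, p ^ k • x = 0) :
    ∃ n, ∀ x ∈ T.map (nsmulAddMonoidHom (p ^ n)),
      ∃ y ∈ T.map (nsmulAddMonoidHom (p ^ n)), p • y = x := by
  let V : ℕ → Submodule (ZMod p) M := fun n =>
    AddSubgroup.toZModSubmodule p ((T.map (nsmulAddMonoidHom (p ^ n))).comap i)
  have hV : ∀ n m, m ∈ V n ↔ ∃ t ∈ T, p ^ n • t = i m := fun n m => Iff.rfl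
  have hanti : ∀ n k, V (n + k) ≤ V n := by
    intro n k m hm
    obtain ⟨t, ht, htm⟩ := (hV _ m).1 hm
    exact (hV n m).2 ⟨p ^ k • t, T.nsmul_mem ht _, by rw [← mul_nsmul', ← pow_add, htm]⟩
  -- Only positive exponents compete, as `IsSemiGeneralizedCoBassian.exists_nsmul_eq` needs one; the
  -- `V n` decrease, so the least dimension persists.
  obtain ⟨n, hn⟩ : ∃ n, ∀ m, Module.rank (ZMod p) (V (n + 1)) ≤ Module.rank (ZMod p) (V (m + 1)) := by
    obtain ⟨_, ⟨n, rfl⟩, hmin⟩ := wellFounded_lt.has_min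
      (Set.range fun n => Module.rank (ZMod p) (V (n + 1))) (Set.range_nonempty _)
    exact ⟨n, fun m => not_lt.1 (hmin _ ⟨m, rfl⟩)⟩
  have hrank : ∀ k, Module.rank (ZMod p) (V (n + 1 + k)) = Module.rank (ZMod p) (V (n + 1)) :=
    fun k => le_antisymm (Submodule.rank_mono (hanti _ k)) (by
      have h := hn (n + k)
      rwa [add_right_comm] at h)
  set P := T.map (nsmulAddMonoidHom (p ^ (n + 1))) with hPdef
  have hP : ∀ x ∈ P, ∃ k : ℕ, p ^ k • x = 0 := by
    rintro _ ⟨t, ht, rfl⟩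
    exact (hT _).1 (T.nsmul_mem ht _)
  have hU : ∀ k m, m ∈ V (n + 1 + k) ↔ ∃ y ∈ P, p ^ k • y = i m := by
    intro k m
    rw [hV]
    constructor
    · rintro ⟨t, ht, htm⟩
      exact ⟨_, ⟨t, ht, rfl⟩, by
        rw [← htm, add_comm (n + 1), pow_add p k, mul_nsmul']
        rfl⟩
    · rintro ⟨_, ⟨t, ht, rfl⟩, htm⟩
      refine ⟨t, ht, ?_⟩
      rw [← htm, add_comm (n + 1), pow_add p k, mul_nsmul']
      rfl
  refine ⟨n + 1, ?_⟩
  rcases le_or_gt ℵ₀ (Module.rank (ZMod p) (V (n + 1))) with hinf | hfin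
  · obtain ⟨H, hHP, hd, e, he, hinj⟩ := exists_embedding_into_divisible_quotient hi hrange hP
      (U := fun k => V (n + 1 + k)) hU hinf hrank
    exact hG.exists_nsmul_eq hp.out hT hPdef hHP hd e he hinj
  · have : FiniteDimensional (ZMod p) (V (n + 1)) := Module.rank_lt_aleph0_iff.1 hfin
    refine exists_nsmul_eq_of_forall_socle hP fun x hx hpx k => ?_
    obtain ⟨m, rfl⟩ := hrange x hpx
    have heq := Submodule.eq_of_le_of_finrank_eq (hanti (n + 1) k)
      (congrArg Cardinal.toNat (hrank k))
    refine (hU k m).1 ?_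
    rw [heq]
    exact (hU 0 m).2 ⟨_, hx, by simp⟩

theorem proposition2 {G : Type*} [AddCommGroup G] (hG : IsSemiGeneralizedCoBassian G)
    (p : ℕ) [Fact p.Prime] :
    IsSemiGeneralizedCoBassian (AddCommGroup.primaryComponent G p) := by
  have hp : p.Prime := Fact.out
  have hT : ∀ x, x ∈ AddCommGroup.primaryComponent G p ↔ ∃ k : ℕ, p ^ k • x = 0 :=
    fun x => Iff.rfl
  let A : AddSubgroup G := (nsmulAddMonoidHom p : G →+ G).ker
  let _ : Module (ZMod p) A := AddCommGroup.zmodModule fun x => Subtype.ext x.2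
  obtain ⟨n, hn⟩ := hG.exists_divisible_map_nsmul (i := A.subtype) Subtype.val_injective
    (fun g hg => ⟨⟨g, hg⟩, rfl⟩) hT
  obtain ⟨K, hK⟩ := exists_isCompl_of_divisible hp hT n hn
  exact hG.of_isCompl hK
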